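/- Consider smooth functions $a,b,f:[0,\infty)\to\mathbb{R}$ with $a,b>0$ on $(0,\infty)$, $f(0)=f'(0)=0$, satisfying for all $r>0$ the equations $$f''=\frac{a''}{a}+2\frac{b''}{b}-1,\qquad a''=-2\frac{a'b'}{b}+a'f'+a,\qquad b''=\frac{1-(b')^2}{b}-\frac{a'b'}{a}+b'f'+b,$$ i.e. the gradient expanding Ricci soliton equations $\mathrm{Ric}_g+\nabla^2 f+g=0$ for the metric $g=dr^2+a(r)^2g_{S^1}+b(r)^2g_{S^2}$. Say that $(a,b,f)$ is a soliton on $S^1\times\mathbb{R}^3$ with parameters $(a_0,f_0)$ if $a(0)=a_0$, $a'(0)=0$, $b(0)=0$, $b'(0)=1$, $f''(0)=f_0$, and a soliton on $S^2\times\mathbb{R}^2$ with parameters $(b_0,f_0)$ if $a(0)=0$, $a'(0)=1$, $b(0)=b_0$, $b'(0)=0$, $f''(0)=f_0$. Write $a'_\infty=\lim_{r\to\infty}a'(r)$ and $b'_\infty=\lim_{r\to\infty}b'(r)$ for the asymptotic slopes. Fix $\delta\in(0,1)$. 1. Let $(a_i,b_i,f_i)_{i\in\mathbb{N}}$ be solitons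 on $S^1\times\mathbb{R}^3$ with parameters $(a_0^i,f_0^i)$, where $a_0^i\in[\delta,1/\delta]$, $f_0^i<0$ and $f_0^i\to0$ as $i\to\infty$. Then the slopes $a'_{\infty,i}$ and $b'_{\infty,i}$ exist as finite limits for every $i$, and $a'_{\infty,i}\to\infty$ and $b'_{\infty,i}\to\infty$ as $i\to\infty$. 2. Let $(a_i,b_i,f_i)_{i\in\mathbb{N}}$ be solitons on $S^2\times\mathbb{R}^2$ with parameters $(b_0^i,f_0^i)$, where $b_0^i\in[\delta,1/\delta]$, $f_0^i<0$ and $f_0^i\to0$ as $i\to\infty$. Then the slopes $a'_{\infty,i}$ and $b'_{\infty,i}$ exist as finite limits for every $i$, and $a'_{\infty,i}\to\infty$ and $b'_{\infty,i}\to\infty$ as $i\to\infty$. -/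

import Mathlib

open Set Filter Topology
open scoped ContDiff

noncomputable section

/-- First derivative on the half-line `[0, ∞)` (one-sided at `0`). -/
def D1 (u : ℝ → ℝ) : ℝ → ℝ := fun r => derivWithin u (Ici 0) r

/-- Second derivative on the half-line `[0, ∞)` (one-sided at `0`). -/
def D2 (u : ℝ → ℝ) : ℝ → ℝ := D1 (D1 u)

/-- `(a, b, f)` is a complete solution of the gradient expanding soliton equations
`Ric + ∇² f + g = 0` for the doubly warped product `g = dr² + a(r)² g_{S¹} + b(r)² g_{S²}`:
smooth on `[0, ∞)`, with positive warping functions on `(0, ∞)`, and with the potential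
normalized by `f(0) = 0`, `f'(0) = 0`. -/
structure IsExpandingSolitonProfile (a b f : ℝ → ℝ) : Prop where
  smooth_a : ContDiffOn ℝ ∞ a (Ici 0)
  smooth_b : ContDiffOn ℝ ∞ b (Ici 0)
  smooth_f : ContDiffOn ℝ ∞ f (Ici 0)
  pos_a : ∀ r : ℝ, 0 < r → 0 < a r
  pos_b : ∀ r : ℝ, 0 < r → 0 < b r
  eq_f : ∀ r : ℝ, 0 < r → D2 f r = D2 a r / a r + 2 * (D2 b r / b r) - 1
  eq_a : ∀ r : ℝ, 0 < r →
    D2 a r = -2 * (D1 a r * D1 b r / b r) + D1 a r * D1 f r + a r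
  eq_b : ∀ r : ℝ, 0 < r →
    D2 b r = (1 - D1 b r ^ 2) / b r - D1 a r * D1 b r / a r + D1 b r * D1 f r + b r
  f_zero : f 0 = 0
  f'_zero : D1 f 0 = 0

/-- Soliton profile with the boundary conditions of the topology `S¹ × ℝ³` and
parameters `a(0) = a₀`, `f''(0) = f₀`. -/
structure IsSolitonS1R3 (a b f : ℝ → ℝ) (a₀ f₀ : ℝ) : Prop
    extends IsExpandingSolitonProfile a b f where
  a_zero : a 0 = a₀
  a'_zero : D1 a 0 = 0
  b_zero : b 0 = 0
  b'_zero : D1 b 0 = 1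
  f''_zero : D2 f 0 = f₀

/-- Soliton profile with the boundary conditions of the topology `S² × ℝ²` and
parameters `b(0) = b₀`, `f''(0) = f₀`. -/
structure IsSolitonS2R2 (a b f : ℝ → ℝ) (b₀ f₀ : ℝ) : Prop
    extends IsExpandingSolitonProfile a b f where
  a_zero : a 0 = 0
  a'_zero : D1 a 0 = 1
  b_zero : b 0 = b₀
  b'_zero : D1 b 0 = 0
  f''_zero : D2 f 0 = f₀

/-- The asymptotic slopes of the warping functions: `a'(r) → a'_∞` and `b'(r) → b'_∞` (finite
limits) as `r → ∞`. The pair is unique, and the asymptotic cone is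
`ds² + (a'_∞ s)² g_{S¹} + (b'_∞ s)² g_{S²}`. -/
def HasAsymptoticSlopes (a b : ℝ → ℝ) (a'inf b'inf : ℝ) : Prop :=
  Tendsto (D1 a) atTop (𝓝 a'inf) ∧ Tendsto (D1 b) atTop (𝓝 b'inf)

end

/-! Put F = -f, g = F', H = a'/a + 2b'/b. The soliton equations have a first integral F'' + HF' +
(F')² = 2F + c, where smoothness at the origin forces c = -3f₀ on S¹ × ℝ³ and c = -2f₀ on S² × ℝ².
Set s = 2F + c, so s(0) = c > 0. The quantities a'/a, b'/b and g/s obey Riccati-type equations with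
the same damping H + g. Comparing them shows that the excesses a'/a - g/s and b'/b - g/s are
nonnegative (`excess_a_nonneg`, `excess_b_nonneg`). As g/s is the logarithmic derivative of √s, both
a/√s and b/√s are nondecreasing.

At infinity √s grows at least linearly, the excesses are O(1/s) (`eventually_mul_s_le`) and g/√s →
1. Hence a/√s and b/√s have finite limits, and these are also the limits of a' and b'
(`exists_slope`). So each slope is at least u(r)/√s(r) for every r ≥ 0, with u = a or b.

The divergence of the slopes follows by choosing r. For the factor that does not collapse, r = 0
gives u(0)/√c with u(0) ≥ δ. For the collapsing one take r = 1: s(1) ≤ c e² tends to 0 (`s_le_exp`),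
while u(1) stays bounded below by integrating the equations over [0, 1] (`exp_le_b_one`,
`exp_le_a_one`). -/

/-! ### Monotonicity and barrier tools. -/

/-- A function on `[r₀, ∞)` with nonnegative derivative in the interior is monotone. -/
theorem monotoneOn_Ici_of_hasDerivAt {u u' : ℝ → ℝ} {r₀ : ℝ} (hc : ContinuousOn u (Ici r₀))
    (hd : ∀ r, r₀ < r → HasDerivAt u (u' r) r) (hn : ∀ r, r₀ < r → 0 ≤ u' r) :
    MonotoneOn u (Ici r₀) := by
  refine monotoneOn_of_deriv_nonneg (convex_Ici r₀) hc ?_ ?_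
  · rw [interior_Ici]
    exact fun r hr => (hd r hr).differentiableAt.differentiableWithinAt
  · rw [interior_Ici]
    exact fun r hr => (hd r hr).deriv ▸ hn r hr

theorem strictMonoOn_Ici_of_hasDerivAt {u u' : ℝ → ℝ} {r₀ : ℝ} (hc : ContinuousOn u (Ici r₀))
    (hd : ∀ r, r₀ < r → HasDerivAt u (u' r) r) (hn : ∀ r, r₀ < r → 0 < u' r) :
    StrictMonoOn u (Ici r₀) := by
  refine strictMonoOn_of_deriv_pos (convex_Ici r₀) hc ?_
  rw [interior_Ici]
  exact fun r hr => (hd r hr).deriv ▸ hn r hr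

theorem monotoneOn_Icc_of_hasDerivAt {u u' : ℝ → ℝ} {r₀ r₁ : ℝ} (hc : ContinuousOn u (Icc r₀ r₁))
    (hd : ∀ r ∈ Ioo r₀ r₁, HasDerivAt u (u' r) r) (hn : ∀ r ∈ Ioo r₀ r₁, 0 ≤ u' r) :
    MonotoneOn u (Icc r₀ r₁) := by
  refine monotoneOn_of_deriv_nonneg (convex_Icc r₀ r₁) hc ?_ ?_
  · rw [interior_Icc]
    exact fun r hr => (hd r hr).differentiableAt.differentiableWithinAt
  · rw [interior_Icc]
    exact fun r hr => (hd r hr).deriv ▸ hn r hr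

/-- Barrier principle: a function that starts below `C` and is nonincreasing wherever it
exceeds `C` stays below `C`. -/
theorem le_of_deriv_nonpos_above {u u' : ℝ → ℝ} {r₀ C : ℝ}
    (hd : ∀ r, r₀ ≤ r → HasDerivAt u (u' r) r) (h0 : u r₀ ≤ C)
    (hn : ∀ r, r₀ ≤ r → C < u r → u' r ≤ 0) : ∀ r, r₀ ≤ r → u r ≤ C := by
  intro r hr
  by_contra! hlt
  have hc : ContinuousOn u (Icc r₀ r) := fun x hx => (hd x hx.1).continuousAt.continuousWithinAt
  have hcomp : IsCompact (Icc r₀ r ∩ u ⁻¹' Iic C) :=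
    isCompact_Icc.of_isClosed_subset (hc.preimage_isClosed_of_isClosed isClosed_Icc isClosed_Iic)
      inter_subset_left
  obtain ⟨t, ⟨ht, htC⟩, hmax⟩ := hcomp.exists_isGreatest ⟨r₀, ⟨le_rfl, hr⟩, h0⟩
  have habove : ∀ x ∈ Ioo t r, C < u x := by
    intro x hx
    by_contra! hx'
    exact absurd (hmax ⟨⟨ht.1.trans hx.1.le, hx.2.le⟩, hx'⟩) (not_le.2 hx.1)
  have hmono : MonotoneOn (fun x => -u x) (Icc t r) :=
    monotoneOn_Icc_of_hasDerivAt (u' := fun x => -u' x) ((hc.mono (Icc_subset_Icc_left ht.1)).neg)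
      (fun x hx => (hd x (ht.1.trans hx.1.le)).neg)
      (fun x hx => neg_nonneg.2 (hn x (ht.1.trans hx.1.le) (habove x hx)))
  have := hmono ⟨le_rfl, ht.2⟩ ⟨ht.2, le_rfl⟩ ht.2
  have htC' : u t ≤ C := htC
  simp only at this
  linarith

/-! ### The first-order system: divergence forms and signs. -/

/-- First-order form of the expanding soliton equations. Here `A = a'`, `B = b'`, `F = -f`,
`g = F'`, and the second-order equation for `f` has been replaced by its first integral
`F'' + (a'/a + 2b'/b) F' + (F')² = 2F + c`. -/
structure ReducedExpander (a b F A B g : ℝ → ℝ) (c : ℝ) : Prop where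
  c_pos : 0 < c
  cont_a : ContinuousOn a (Ici 0)
  cont_b : ContinuousOn b (Ici 0)
  cont_F : ContinuousOn F (Ici 0)
  cont_A : ContinuousOn A (Ici 0)
  cont_B : ContinuousOn B (Ici 0)
  cont_g : ContinuousOn g (Ici 0)
  pos_a : ∀ r, 0 < r → 0 < a r
  pos_b : ∀ r, 0 < r → 0 < b r
  deriv_a : ∀ r, 0 < r → HasDerivAt a (A r) r
  deriv_b : ∀ r, 0 < r → HasDerivAt b (B r) r
  deriv_F : ∀ r, 0 < r → HasDerivAt F (g r) r
  deriv_A : ∀ r, 0 < r → HasDerivAt A (a r - 2 * (A r * B r / b r) - A r * g r) r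
  deriv_B : ∀ r, 0 < r →
    HasDerivAt B ((1 - B r ^ 2) / b r - A r * B r / a r - B r * g r + b r) r
  deriv_g : ∀ r, 0 < r →
    HasDerivAt g (2 * F r + c - (A r / a r + 2 * (B r / b r) + g r) * g r) r
  F_zero : F 0 = 0
  g_zero : g 0 = 0
  A_zero_nonneg : 0 ≤ A 0
  B_mul_zero : B 0 * b 0 = 0

namespace ReducedExpander

variable {a b F A B g : ℝ → ℝ} {c : ℝ}

theorem deriv_exp (S : ReducedExpander a b F A B g c)
    {r : ℝ} (hr : 0 < r) :
    HasDerivAt (fun r => Real.exp (F r)) (Real.exp (F r) * g r) r := (S.deriv_F r hr).exp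

theorem cont_exp (S : ReducedExpander a b F A B g c) :
    ContinuousOn (fun r => Real.exp (F r)) (Ici 0) := S.cont_F.rexp

/-- The factor b² e^F absorbs both damping terms of a''. This puts the equation in divergence form
with a positive source, so signs and bounds follow by integrating from the origin. -/
theorem deriv_weighted_A (S : ReducedExpander a b F A B g c)
    {r : ℝ} (hr : 0 < r) :
    HasDerivAt (fun r => A r * b r ^ 2 * Real.exp (F r)) (a r * b r ^ 2 * Real.exp (F r)) r := by
  have hb := (S.pos_b r hr).ne'
  refine (((S.deriv_A r hr).mul ((S.deriv_b r hr).pow 2)).mul (S.deriv_exp hr)).congr_deriv ?_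
  simp only [Pi.mul_apply, Pi.pow_apply]
  field_simp
  push_cast
  ring

/-- Weighting b' by b rather than b² also cancels the quadratic term (b')²/b and leaves a source
with no singularity where b vanishes. -/
theorem deriv_weighted_B (S : ReducedExpander a b F A B g c)
    {r : ℝ} (hr : 0 < r) :
    HasDerivAt (fun r => B r * b r * a r * Real.exp (F r))
      (a r * (1 + b r ^ 2) * Real.exp (F r)) r := by
  have hb := (S.pos_b r hr).ne'
  have ha := (S.pos_a r hr).ne'
  refine ((((S.deriv_B r hr).mul (S.deriv_b r hr)).mul (S.deriv_a r hr)).mul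
    (S.deriv_exp hr)).congr_deriv ?_
  simp only [Pi.mul_apply]
  field_simp
  ring

theorem deriv_weighted_g (S : ReducedExpander a b F A B g c)
    {r : ℝ} (hr : 0 < r) :
    HasDerivAt (fun r => g r * a r * b r ^ 2 * Real.exp (F r))
      ((2 * F r + c) * (a r * b r ^ 2 * Real.exp (F r))) r := by
  have hb := (S.pos_b r hr).ne'
  have ha := (S.pos_a r hr).ne'
  refine ((((S.deriv_g r hr).mul (S.deriv_a r hr)).mul ((S.deriv_b r hr).pow 2)).mul
    (S.deriv_exp hr)).congr_deriv ?_
  simp only [Pi.mul_apply, Pi.pow_apply]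
  field_simp
  push_cast
  ring

theorem A_pos (S : ReducedExpander a b F A B g c)
    {r : ℝ} (hr : 0 < r) : 0 < A r := by
  have hm := strictMonoOn_Ici_of_hasDerivAt ((S.cont_A.mul (S.cont_b.pow 2)).mul S.cont_exp)
    (fun r hr => S.deriv_weighted_A hr) (fun r hr => by
      have := S.pos_a r hr; have := S.pos_b r hr; positivity)
  have h := hm (mem_Ici.2 le_rfl) (mem_Ici.2 hr.le) hr
  simp only [Pi.mul_apply, Pi.pow_apply] at h
  have h0 : 0 ≤ A 0 * b 0 ^ 2 * Real.exp (F 0) := by have := S.A_zero_nonneg; positivity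
  have hb := S.pos_b r hr
  have h1 : 0 < A r * (b r ^ 2 * Real.exp (F r)) := by nlinarith
  exact pos_of_mul_pos_left h1 (by positivity)

theorem B_pos (S : ReducedExpander a b F A B g c)
    {r : ℝ} (hr : 0 < r) : 0 < B r := by
  have hm := strictMonoOn_Ici_of_hasDerivAt
    (((S.cont_B.mul S.cont_b).mul S.cont_a).mul S.cont_exp)
    (fun r hr => S.deriv_weighted_B hr) (fun r hr => by
      have := S.pos_a r hr; have := S.pos_b r hr; positivity)
  have h := hm (mem_Ici.2 le_rfl) (mem_Ici.2 hr.le) hr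
  simp only [Pi.mul_apply, S.B_mul_zero, zero_mul] at h
  have hb := S.pos_b r hr
  have ha := S.pos_a r hr
  have h1 : 0 < B r * (b r * a r * Real.exp (F r)) := by nlinarith
  exact pos_of_mul_pos_left h1 (by positivity)

theorem g_nonneg_of_F_ge (S : ReducedExpander a b F A B g c)
    {t : ℝ} (h : ∀ r ∈ Ioo 0 t, -c ≤ 2 * F r) :
    ∀ r ∈ Ioc 0 t, 0 ≤ g r := by
  intro r hr
  have hm := monotoneOn_Icc_of_hasDerivAt (r₀ := 0) (r₁ := t)
    ((((S.cont_g.mul S.cont_a).mul (S.cont_b.pow 2)).mul S.cont_exp).mono Icc_subset_Ici_self)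
    (fun r hr => S.deriv_weighted_g hr.1) (fun r hr => by
      have := S.pos_a r hr.1; have := S.pos_b r hr.1
      have : 0 ≤ 2 * F r + c := by linarith [h r hr]
      positivity)
  have h := hm ⟨le_rfl, hr.1.le.trans hr.2⟩ ⟨hr.1.le, hr.2⟩ hr.1.le
  simp only [Pi.mul_apply, S.g_zero, zero_mul, Pi.pow_apply] at h
  have hb := S.pos_b r hr.1
  have ha := S.pos_a r hr.1
  have h1 : 0 ≤ g r * (a r * b r ^ 2 * Real.exp (F r)) := by nlinarith
  exact nonneg_of_mul_nonneg_left h1 (by positivity)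

theorem F_nonneg_of_F_ge (S : ReducedExpander a b F A B g c)
    {t : ℝ} (ht : 0 ≤ t) (h : ∀ r ∈ Ioo 0 t, -c ≤ 2 * F r) : 0 ≤ F t := by
  have hm := monotoneOn_Icc_of_hasDerivAt (r₀ := 0) (r₁ := t) (S.cont_F.mono Icc_subset_Ici_self)
    (fun r hr => S.deriv_F r hr.1)
    (fun r hr => S.g_nonneg_of_F_ge h r ⟨hr.1, hr.2.le⟩)
  simpa [S.F_zero] using hm ⟨le_rfl, ht⟩ ⟨ht, le_rfl⟩ ht

/-- Continuation argument: up to the first point where 2F ≤ -c the source of the weighted g equation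
is nonnegative, so F ≥ 0 there, which is incompatible with c > 0. -/
theorem F_gt (S : ReducedExpander a b F A B g c)
    {r : ℝ} (hr : 0 ≤ r) : -c < 2 * F r := by
  have hcpos := S.c_pos
  by_contra! hle
  have hcomp : IsCompact (Icc 0 r ∩ F ⁻¹' Iic (-c / 2)) :=
    isCompact_Icc.of_isClosed_subset
      ((S.cont_F.mono Icc_subset_Ici_self).preimage_isClosed_of_isClosed isClosed_Icc isClosed_Iic)
      inter_subset_left
  obtain ⟨t, ⟨ht, htC⟩, hmin⟩ := hcomp.exists_isLeast ⟨r, ⟨hr, le_rfl⟩, by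
    simp only [mem_preimage, mem_Iic]; linarith⟩
  have h0 := S.F_nonneg_of_F_ge ht.1 (fun x hx => by
    by_contra! hx'
    exact absurd (hmin ⟨⟨hx.1.le, hx.2.le.trans ht.2⟩, by
      simp only [mem_preimage, mem_Iic]; linarith⟩) (not_le.2 hx.2))
  simp only [mem_preimage, mem_Iic] at htC
  linarith

theorem F_nonneg (S : ReducedExpander a b F A B g c)
    {r : ℝ} (hr : 0 ≤ r) : 0 ≤ F r :=
  S.F_nonneg_of_F_ge hr fun _ hx => (S.F_gt hx.1.le).le

theorem g_nonneg (S : ReducedExpander a b F A B g c)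
    {r : ℝ} (hr : 0 ≤ r) : 0 ≤ g r := by
  rcases hr.eq_or_lt with rfl | hr
  · exact S.g_zero.ge
  · exact S.g_nonneg_of_F_ge (fun _ hx => (S.F_gt hx.1.le).le) r ⟨hr, le_rfl⟩

theorem g_pos (S : ReducedExpander a b F A B g c)
    {r : ℝ} (hr : 0 < r) : 0 < g r := by
  have hcpos := S.c_pos
  have hm := strictMonoOn_Ici_of_hasDerivAt
    (((S.cont_g.mul S.cont_a).mul (S.cont_b.pow 2)).mul S.cont_exp)
    (fun r hr => S.deriv_weighted_g hr) (fun r hr => by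
      have := S.pos_a r hr; have := S.pos_b r hr; have := S.F_nonneg hr.le
      positivity)
  have h := hm (mem_Ici.2 le_rfl) (mem_Ici.2 hr.le) hr
  simp only [Pi.mul_apply, S.g_zero, zero_mul, Pi.pow_apply] at h
  have hb := S.pos_b r hr
  have ha := S.pos_a r hr
  have h1 : 0 < g r * (a r * b r ^ 2 * Real.exp (F r)) := by nlinarith
  exact pos_of_mul_pos_left h1 (by positivity)

/-! ### The function s = 2F + c and the excesses over g/s. -/

theorem s_ge (S : ReducedExpander a b F A B g c)
    {r : ℝ} (hr : 0 ≤ r) : c ≤ 2 * F r + c := by linarith [S.F_nonneg hr]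

theorem s_pos (S : ReducedExpander a b F A B g c)
    {r : ℝ} (hr : 0 ≤ r) : 0 < 2 * F r + c := S.c_pos.trans_le (S.s_ge hr)

theorem cont_s (S : ReducedExpander a b F A B g c) :
    ContinuousOn (fun r => 2 * F r + c) (Ici 0) :=
  (continuousOn_const.mul S.cont_F).add continuousOn_const

theorem deriv_s (S : ReducedExpander a b F A B g c)
    {r : ℝ} (hr : 0 < r) : HasDerivAt (fun r => 2 * F r + c) (2 * g r) r :=
  ((S.deriv_F r hr).const_mul 2).add_const c

theorem cont_g_div_s (S : ReducedExpander a b F A B g c) :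
    ContinuousOn (fun r => g r / (2 * F r + c)) (Ici 0) :=
  S.cont_g.div S.cont_s fun _ hr => (S.s_pos hr).ne'

/-- Since s' = 2g, dividing by s turns the source s of the g equation into 1, the same source as for
a'/a; the price is the extra term -2(g/s)². -/
theorem deriv_g_div_s (S : ReducedExpander a b F A B g c)
    {r : ℝ} (hr : 0 < r) :
    HasDerivAt (fun r => g r / (2 * F r + c))
      (1 - (A r / a r + 2 * (B r / b r) + g r) * (g r / (2 * F r + c))
        - 2 * (g r / (2 * F r + c)) ^ 2) r := by
  have hs := (S.s_pos hr.le).ne'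
  refine ((S.deriv_g r hr).div (S.deriv_s hr) hs).congr_deriv ?_
  generalize 2 * F r + c = s at *
  field_simp

theorem deriv_A_div_a (S : ReducedExpander a b F A B g c)
    {r : ℝ} (hr : 0 < r) :
    HasDerivAt (fun r => A r / a r)
      (1 - (A r / a r + 2 * (B r / b r) + g r) * (A r / a r)) r := by
  have ha := (S.pos_a r hr).ne'
  have hb := (S.pos_b r hr).ne'
  refine ((S.deriv_A r hr).div (S.deriv_a r hr) ha).congr_deriv ?_
  field_simp
  ring

theorem deriv_B_div_b (S : ReducedExpander a b F A B g c)
    {r : ℝ} (hr : 0 < r) :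
    HasDerivAt (fun r => B r / b r)
      (1 + 1 / b r ^ 2 - (A r / a r + 2 * (B r / b r) + g r) * (B r / b r)) r := by
  have ha := (S.pos_a r hr).ne'
  have hb := (S.pos_b r hr).ne'
  refine ((S.deriv_B r hr).div (S.deriv_b r hr) hb).congr_deriv ?_
  field_simp
  ring

theorem deriv_excess_a (S : ReducedExpander a b F A B g c)
    {r : ℝ} (hr : 0 < r) :
    HasDerivAt (fun r => A r / a r - g r / (2 * F r + c))
      (-(A r / a r + 2 * (B r / b r) + g r) * (A r / a r - g r / (2 * F r + c))
        + 2 * (g r / (2 * F r + c)) ^ 2) r :=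
  ((S.deriv_A_div_a hr).sub (S.deriv_g_div_s hr)).congr_deriv (by ring)

theorem deriv_excess_b (S : ReducedExpander a b F A B g c)
    {r : ℝ} (hr : 0 < r) :
    HasDerivAt (fun r => B r / b r - g r / (2 * F r + c))
      (-(A r / a r + 2 * (B r / b r) + g r) * (B r / b r - g r / (2 * F r + c))
        + (1 / b r ^ 2 + 2 * (g r / (2 * F r + c)) ^ 2)) r :=
  ((S.deriv_B_div_b hr).sub (S.deriv_g_div_s hr)).congr_deriv (by ring)

/-- The excess has a nonnegative source, and a b² e^F is an integrating factor for its damping. The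
product is written without dividing by a or b, so it is continuous at the origin, where g = 0 makes
it nonnegative. -/
theorem excess_a_nonneg (S : ReducedExpander a b F A B g c)
    {r : ℝ} (hr : 0 < r) : 0 ≤ A r / a r - g r / (2 * F r + c) := by
  have hm := monotoneOn_Ici_of_hasDerivAt (r₀ := 0)
    (u := fun r => (A r - a r * (g r / (2 * F r + c))) * b r ^ 2 * Real.exp (F r))
    (u' := fun r => 2 * (g r / (2 * F r + c)) ^ 2 * (a r * b r ^ 2 * Real.exp (F r)))
    (((S.cont_A.sub (S.cont_a.mul S.cont_g_div_s)).mul (S.cont_b.pow 2)).mul S.cont_exp)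
    (fun r hr => by
      have ha := (S.pos_a r hr).ne'
      have hb := (S.pos_b r hr).ne'
      refine ((((S.deriv_A r hr).sub ((S.deriv_a r hr).mul (S.deriv_g_div_s hr))).mul
        ((S.deriv_b r hr).pow 2)).mul (S.deriv_exp hr)).congr_deriv ?_
      simp only [Pi.mul_apply, Pi.pow_apply, Pi.sub_apply]
      generalize g r / (2 * F r + c) = v
      field_simp
      push_cast
      ring)
    (fun r hr => by have := S.pos_a r hr; positivity)
  have h := hm (mem_Ici.2 le_rfl) (mem_Ici.2 hr.le) hr.le
  have ha := S.pos_a r hr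
  have hb := S.pos_b r hr
  have h0 := S.A_zero_nonneg
  have h1 : 0 ≤ (A r - a r * (g r / (2 * F r + c))) * b r ^ 2 * Real.exp (F r) := by
    refine le_trans ?_ h
    simp only [S.g_zero, zero_div, mul_zero, sub_zero]
    positivity
  have h2 : (A r - a r * (g r / (2 * F r + c))) * b r ^ 2 * Real.exp (F r)
      = (A r / a r - g r / (2 * F r + c)) * (a r * b r ^ 2 * Real.exp (F r)) := by
    field_simp
  rw [h2] at h1
  exact nonneg_of_mul_nonneg_left h1 (by positivity)

theorem excess_b_nonneg (S : ReducedExpander a b F A B g c)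
    {r : ℝ} (hr : 0 < r) : 0 ≤ B r / b r - g r / (2 * F r + c) := by
  have hm := monotoneOn_Ici_of_hasDerivAt (r₀ := 0)
    (u := fun r => (B r - b r * (g r / (2 * F r + c))) * b r * a r * Real.exp (F r))
    (u' := fun r => (1 / b r ^ 2 + 2 * (g r / (2 * F r + c)) ^ 2)
      * (a r * b r ^ 2 * Real.exp (F r)))
    ((((S.cont_B.sub (S.cont_b.mul S.cont_g_div_s)).mul S.cont_b).mul S.cont_a).mul S.cont_exp)
    (fun r hr => by
      have ha := (S.pos_a r hr).ne'
      have hb := (S.pos_b r hr).ne'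
      refine (((((S.deriv_B r hr).sub ((S.deriv_b r hr).mul (S.deriv_g_div_s hr))).mul
        (S.deriv_b r hr)).mul (S.deriv_a r hr)).mul (S.deriv_exp hr)).congr_deriv ?_
      simp only [Pi.mul_apply, Pi.sub_apply]
      generalize g r / (2 * F r + c) = v
      field_simp
      ring)
    (fun r hr => by have := S.pos_a r hr; positivity)
  have h := hm (mem_Ici.2 le_rfl) (mem_Ici.2 hr.le) hr.le
  have ha := S.pos_a r hr
  have hb := S.pos_b r hr
  have h1 : 0 ≤ (B r - b r * (g r / (2 * F r + c))) * b r * a r * Real.exp (F r) := by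
    refine le_trans ?_ h
    simp only [S.g_zero, zero_div, mul_zero, sub_zero, S.B_mul_zero, zero_mul, le_refl]
  have h2 : (B r - b r * (g r / (2 * F r + c))) * b r * a r * Real.exp (F r)
      = (B r / b r - g r / (2 * F r + c)) * (a r * b r ^ 2 * Real.exp (F r)) := by
    field_simp
  rw [h2] at h1
  exact nonneg_of_mul_nonneg_left h1 (by positivity)

/-! ### Monotonicity of the ratios u/√s. -/

theorem sqrt_s_pos (S : ReducedExpander a b F A B g c)
    {r : ℝ} (hr : 0 ≤ r) : 0 < √(2 * F r + c) := Real.sqrt_pos.2 (S.s_pos hr)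

theorem deriv_sqrt_s (S : ReducedExpander a b F A B g c)
    {r : ℝ} (hr : 0 < r) :
    HasDerivAt (fun r => √(2 * F r + c)) (g r / √(2 * F r + c)) r :=
  ((S.deriv_s hr).sqrt (S.s_pos hr.le).ne').congr_deriv (by
    have := S.sqrt_s_pos hr.le
    field_simp)

theorem cont_sqrt_s (S : ReducedExpander a b F A B g c) :
    ContinuousOn (fun r => √(2 * F r + c)) (Ici 0) := S.cont_s.sqrt

/-- The derivative of `u / √s` is controlled by the excess `u' / u - g / s`. -/
theorem deriv_div_sqrt_s (S : ReducedExpander a b F A B g c)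
    {u U : ℝ → ℝ} {r : ℝ} (hr : 0 < r) (hu : HasDerivAt u (U r) r)
    (hpos : 0 < u r) :
    HasDerivAt (fun r => u r / √(2 * F r + c))
      ((U r / u r - g r / (2 * F r + c)) * (u r / √(2 * F r + c))) r := by
  have hs := S.sqrt_s_pos hr.le
  refine (hu.div (S.deriv_sqrt_s hr) hs.ne').congr_deriv ?_
  have hsq := Real.sq_sqrt (S.s_pos hr.le).le
  generalize √(2 * F r + c) = σ at *
  rw [← hsq]
  field_simp

theorem monotone_div_sqrt_s (S : ReducedExpander a b F A B g c)
    {u U : ℝ → ℝ} (hc : ContinuousOn u (Ici 0))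
    (hu : ∀ r, 0 < r → HasDerivAt u (U r) r) (hpos : ∀ r, 0 < r → 0 < u r)
    (he : ∀ r, 0 < r → 0 ≤ U r / u r - g r / (2 * F r + c)) :
    MonotoneOn (fun r => u r / √(2 * F r + c)) (Ici 0) :=
  monotoneOn_Ici_of_hasDerivAt (hc.div S.cont_sqrt_s fun _ hr => (S.sqrt_s_pos hr).ne')
    (fun r hr => S.deriv_div_sqrt_s hr (hu r hr) (hpos r hr)) (fun r hr =>
      mul_nonneg (he r hr) (div_nonneg (hpos r hr).le (Real.sqrt_nonneg _)))

/-! ### Upper bounds for g and s. -/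

theorem H_pos (S : ReducedExpander a b F A B g c)
    {r : ℝ} (hr : 0 < r) : 0 < A r / a r + 2 * (B r / b r) := by
  have := S.A_pos hr; have := S.B_pos hr; have := S.pos_a r hr; have := S.pos_b r hr
  positivity

/-- The damping term Hg only helps: (s - g²)e^{2F} is nondecreasing and starts at c. -/
theorem g_sq_le (S : ReducedExpander a b F A B g c)
    {r : ℝ} (hr : 0 ≤ r) : g r ^ 2 ≤ 2 * F r + c := by
  have hm := monotoneOn_Ici_of_hasDerivAt (r₀ := 0)
    (u := fun r => (2 * F r + c - g r ^ 2) * Real.exp (F r) ^ 2)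
    (u' := fun r => 2 * g r * (1 + (A r / a r + 2 * (B r / b r)) * g r) * Real.exp (F r) ^ 2)
    ((S.cont_s.sub (S.cont_g.pow 2)).mul (S.cont_exp.pow 2))
    (fun r hr => by
      refine (((S.deriv_s hr).sub ((S.deriv_g r hr).pow 2)).mul
        ((S.deriv_exp hr).pow 2)).congr_deriv ?_
      simp only [Pi.pow_apply, Pi.sub_apply]
      push_cast
      ring)
    (fun r hr => by have := S.H_pos hr; have := S.g_pos hr; positivity)
  have h := hm (mem_Ici.2 le_rfl) (mem_Ici.2 hr) hr
  have h1 : 0 ≤ (2 * F r + c - g r ^ 2) * Real.exp (F r) ^ 2 := by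
    refine le_trans ?_ h
    simp only [S.g_zero, S.F_zero]
    have := S.c_pos
    simp [this.le]
  have := nonneg_of_mul_nonneg_left h1 (by positivity)
  linarith

theorem g_le_sqrt (S : ReducedExpander a b F A B g c)
    {r : ℝ} (hr : 0 ≤ r) : g r ≤ √(2 * F r + c) :=
  Real.le_sqrt_of_sq_le (S.g_sq_le hr)

/-- Dropping the damping gives s'' ≤ 2s, and s + 2g then grows at rate at most 2. The bound involves
the solution only through c, so it is uniform along a sequence of solitons. -/
theorem s_le_exp (S : ReducedExpander a b F A B g c)
    {r : ℝ} (hr : 0 ≤ r) : 2 * F r + c ≤ c * Real.exp (2 * r) := by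
  have hm := monotoneOn_Ici_of_hasDerivAt (r₀ := 0)
    (u := fun r => -((2 * F r + c + 2 * g r) * Real.exp (-(2 * r))))
    (u' := fun r => (2 * g r + 2 * ((A r / a r + 2 * (B r / b r) + g r) * g r))
      * Real.exp (-(2 * r)))
    ((((S.cont_s.add (continuousOn_const.mul S.cont_g))).mul (by fun_prop)).neg)
    (fun r hr => by
      have he : HasDerivAt (fun r : ℝ => Real.exp (-(2 * r))) (Real.exp (-(2 * r)) * (-(2 * 1))) r :=
        (((hasDerivAt_id r).const_mul 2).neg).exp
      refine ((((S.deriv_s hr).add ((S.deriv_g r hr).const_mul 2)).mul he).neg).congr_deriv ?_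
      simp only [Pi.add_apply]
      ring)
    (fun r hr => by have := S.H_pos hr; have := S.g_pos hr; positivity)
  have h := hm (mem_Ici.2 le_rfl) (mem_Ici.2 hr) hr
  simp only [S.F_zero, S.g_zero, mul_zero, zero_add, add_zero, neg_zero, Real.exp_zero,
    mul_one] at h
  have h2 : (2 * F r + c + 2 * g r) * Real.exp (-(2 * r)) ≤ c := by linarith
  rw [Real.exp_neg, ← div_eq_mul_inv, div_le_iff₀ (Real.exp_pos _)] at h2
  linarith [S.g_nonneg hr]

theorem monotone_b (S : ReducedExpander a b F A B g c) :
    MonotoneOn b (Ici 0) :=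
  monotoneOn_Ici_of_hasDerivAt S.cont_b S.deriv_b fun _ hr => (S.B_pos hr).le

theorem monotone_a (S : ReducedExpander a b F A B g c) :
    MonotoneOn a (Ici 0) :=
  monotoneOn_Ici_of_hasDerivAt S.cont_a S.deriv_a fun _ hr => (S.A_pos hr).le

theorem monotone_F (S : ReducedExpander a b F A B g c) :
    MonotoneOn F (Ici 0) :=
  monotoneOn_Ici_of_hasDerivAt S.cont_F S.deriv_F fun _ hr => (S.g_pos hr).le

/-! ### Lower bound for g and growth of s. -/

/-- H' = 3 + 2/b² - (H + g)H, and b is nondecreasing, so H decreases whenever it exceeds `K` on [1,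
∞). -/
theorem exists_H_bound (S : ReducedExpander a b F A B g c) :
    ∃ M, 0 < M ∧ ∀ r, 1 ≤ r → A r / a r + 2 * (B r / b r) ≤ M := by
  have hb1 := S.pos_b 1 one_pos
  set K := 3 + 2 * (1 / b 1 ^ 2) with hK
  have hK3 : 3 ≤ K := by
    have : 0 ≤ 2 * (1 / b 1 ^ 2) := by positivity
    linarith
  refine ⟨max (A 1 / a 1 + 2 * (B 1 / b 1)) K, lt_max_of_lt_right (by linarith),
    le_of_deriv_nonpos_above (r₀ := 1) (u := fun r => A r / a r + 2 * (B r / b r))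
      (fun r hr => (S.deriv_A_div_a (by linarith)).add
        ((S.deriv_B_div_b (by linarith)).const_mul 2)) (le_max_left _ _) ?_⟩
  intro r hr hlt
  have hr0 : 0 < r := by linarith
  have hHK := (le_max_right _ _).trans_lt hlt
  have hg := S.g_pos hr0
  have hb : 1 / b r ^ 2 ≤ 1 / b 1 ^ 2 := by
    have := S.monotone_b (mem_Ici.2 zero_le_one) (mem_Ici.2 hr0.le) hr
    gcongr
  generalize hp : A r / a r = p at *
  generalize hq : B r / b r = q at *
  have : 0 < p + 2 * q := by linarith
  nlinarith [mul_pos this hg]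

/-- Where g < κ√s, the source s in g' dominates, so g - κ√s cannot cross below zero. -/
theorem exists_lower_bound_g (S : ReducedExpander a b F A B g c) :
    ∃ κ, 0 < κ ∧ ∀ r, 1 ≤ r → κ * √(2 * F r + c) ≤ g r := by
  obtain ⟨M, hM, hHM⟩ := S.exists_H_bound
  have hc := S.c_pos
  have hsc := Real.sqrt_pos.2 hc
  have hg1 := S.g_pos one_pos
  have hσ1 := S.sqrt_s_pos zero_le_one
  -- The first three bounds make g², κ(√s)' and Hg each at most s/4 wherever g < κ√s; the last one
  -- secures the starting point r = 1.
  obtain ⟨κ, hκ, h1, h2, h3, h4⟩ : ∃ κ, 0 < κ ∧ κ ≤ 1 / 2 ∧ κ ≤ √c / 2 ∧ κ ≤ √c / (4 * M) ∧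
      κ ≤ g 1 / √(2 * F 1 + c) := by
    refine ⟨min (min (1 / 2) (√c / 2)) (min (√c / (4 * M)) (g 1 / √(2 * F 1 + c))), ?_, ?_⟩
    · simp only [lt_min_iff]
      exact ⟨⟨by norm_num, by positivity⟩, by positivity, by positivity⟩
    · exact ⟨(min_le_left _ _).trans (min_le_left _ _), (min_le_left _ _).trans (min_le_right _ _),
        (min_le_right _ _).trans (min_le_left _ _), (min_le_right _ _).trans (min_le_right _ _)⟩
  refine ⟨κ, hκ, ?_⟩
  have key := le_of_deriv_nonpos_above (r₀ := 1) (C := 0)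
    (u := fun r => κ * √(2 * F r + c) - g r)
    (fun r hr => ((S.deriv_sqrt_s (by linarith)).const_mul κ).sub (S.deriv_g r (by linarith)))
    (by rw [le_div_iff₀ hσ1] at h4; simpa using h4) (by
      intro r hr hlt
      have hr0 : 0 < r := by linarith
      have hg := S.g_pos hr0
      have hσ := S.sqrt_s_pos hr0.le
      have hs := S.s_ge hr0.le
      have hcσ : √c ≤ √(2 * F r + c) := Real.sqrt_le_sqrt hs
      have hsq := Real.sq_sqrt (S.s_pos hr0.le).le
      have hH := hHM r hr
      have hH0 := S.H_pos hr0
      generalize √(2 * F r + c) = σ at *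
      rw [← hsq]
      generalize A r / a r + 2 * (B r / b r) = H at *
      have hlt' : g r ≤ κ * σ := by linarith
      have t1 : κ * (g r / σ) ≤ σ ^ 2 / 4 := by
        have : g r / σ ≤ κ := (div_le_iff₀ hσ).2 hlt'
        have : κ * (g r / σ) ≤ κ * κ := by gcongr
        nlinarith
      have t2 : H * g r ≤ σ ^ 2 / 4 := by
        rw [le_div_iff₀ (by positivity)] at h3
        have : H * g r ≤ M * (κ * σ) := by gcongr
        nlinarith
      have t3 : g r * g r ≤ σ ^ 2 / 4 := by
        have : g r ≤ σ / 2 := by nlinarith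
        nlinarith
      nlinarith)
  intro r hr
  have := key r hr
  linarith

theorem tendsto_sqrt_s (S : ReducedExpander a b F A B g c) :
    Tendsto (fun r => √(2 * F r + c)) atTop atTop := by
  obtain ⟨κ, hκ, hg⟩ := S.exists_lower_bound_g
  have hm := monotoneOn_Ici_of_hasDerivAt (r₀ := 1) (u := fun r => √(2 * F r + c) - κ * r)
    ((S.cont_sqrt_s.mono (Ici_subset_Ici.2 zero_le_one)).sub (by fun_prop))
    (fun r hr => (S.deriv_sqrt_s (by linarith)).sub ((hasDerivAt_id r).const_mul κ))
    (fun r hr => by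
      have hσ := S.sqrt_s_pos (r := r) (by linarith)
      rw [sub_nonneg, mul_one, le_div_iff₀ hσ]
      exact hg r hr.le)
  have hlin : Tendsto (fun r : ℝ => κ * r + -κ) atTop atTop :=
    tendsto_atTop_add_const_right _ _ (tendsto_id.const_mul_atTop hκ)
  refine tendsto_atTop_mono' _ ?_ hlin
  filter_upwards [eventually_ge_atTop (1 : ℝ)] with r hr
  have h := hm (mem_Ici.2 le_rfl) (mem_Ici.2 hr) hr
  simp only at h
  linarith [S.sqrt_s_pos zero_le_one]

theorem tendsto_s (S : ReducedExpander a b F A B g c) :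
    Tendsto (fun r => 2 * F r + c) atTop atTop := by
  refine ((tendsto_pow_atTop two_ne_zero).comp S.tendsto_sqrt_s).congr' ?_
  filter_upwards [eventually_ge_atTop (0 : ℝ)] with r hr
  exact Real.sq_sqrt (S.s_pos hr).le

/-! ### Decay of the excesses and existence of the slopes. -/

/-- A nonnegative quantity damped at rate at least `g` with source `O(1 / s)` is `O(1 / s)`. -/
theorem eventually_mul_s_le (S : ReducedExpander a b F A B g c)
    {e w : ℝ → ℝ} {C : ℝ} (hC : 0 ≤ C)
    (hd : ∀ r, 1 ≤ r → HasDerivAt e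
      (-(A r / a r + 2 * (B r / b r) + g r) * e r + w r) r)
    (he : ∀ r, 1 ≤ r → 0 ≤ e r) (hw : ∀ r, 1 ≤ r → w r * (2 * F r + c) ≤ C) :
    ∃ K, 0 < K ∧ ∀ᶠ r in atTop, e r * (2 * F r + c) ≤ K := by
  obtain ⟨κ, hκ, hg⟩ := S.exists_lower_bound_g
  -- Once s ≥ 4/κ, the growth term e·s' uses at most half of the damping κ√s·(e s). With √s ≥ 1, the
  -- other half beats the source `C` as soon as e s ≥ 2C/κ.
  obtain ⟨R, hR⟩ := eventually_atTop.1 (((tendsto_atTop.1 S.tendsto_s (4 / κ)).and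
    (tendsto_atTop.1 S.tendsto_sqrt_s 1)).and (eventually_ge_atTop 1))
  refine ⟨max (e R * (2 * F R + c)) (2 * C / κ + 1), lt_max_of_lt_right (by positivity),
    eventually_atTop.2 ⟨R, ?_⟩⟩
  refine le_of_deriv_nonpos_above (u := fun r => e r * (2 * F r + c))
    (fun r hr => (hd r (hR r hr).2).mul (S.deriv_s (by linarith [(hR r hr).2])))
    (le_max_left _ _) ?_
  intro r hr hlt
  obtain ⟨⟨hs4, hσ1⟩, hr1⟩ := hR r hr
  have hr0 : 0 < r := by linarith
  have hlt' := ((le_max_right _ _).trans_lt hlt).le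
  have hsq := Real.sq_sqrt (S.s_pos hr0.le).le
  have hκg := hg r hr1
  have hgσ := S.g_le_sqrt hr0.le
  have hw' := hw r hr1
  have he' := he r hr1
  have hH := S.H_pos hr0
  have hs := S.s_pos hr0.le
  rw [div_le_iff₀ hκ] at hs4
  generalize √(2 * F r + c) = σ at *
  generalize 2 * F r + c = s at *
  generalize A r / a r + 2 * (B r / b r) = H at *
  have hes : 0 ≤ e r * s := by positivity
  have t1 : κ * σ * (e r * s) ≤ (H + g r) * (e r * s) := by gcongr; linarith
  have t2 : e r * (2 * g r) ≤ κ / 2 * σ * (e r * s) := by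
    have h1 : e r * (2 * g r) ≤ e r * (2 * σ) := by gcongr
    have h2 : 4 * (e r * σ) ≤ s * κ * (e r * σ) := by gcongr
    nlinarith
  have t3 : κ / 2 * 1 * (e r * s) ≤ κ / 2 * σ * (e r * s) := by gcongr
  have t4 : C ≤ κ / 2 * (e r * s) := by
    have : κ / 2 * (2 * C / κ) = C := by field_simp
    nlinarith
  nlinarith

theorem g_div_s_sq_mul_le (S : ReducedExpander a b F A B g c)
    {r : ℝ} (hr : 0 < r) :
    (g r / (2 * F r + c)) ^ 2 * (2 * F r + c) ≤ 1 := by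
  have hs := S.s_pos hr.le
  have h := S.g_sq_le hr.le
  generalize 2 * F r + c = s at *
  rw [show (g r / s) ^ 2 * s = g r ^ 2 / s by field_simp]
  exact (div_le_one hs).2 h

theorem eventually_excess_a_le (S : ReducedExpander a b F A B g c) :
    ∃ K, 0 < K ∧ ∀ᶠ r in atTop, (A r / a r - g r / (2 * F r + c)) * (2 * F r + c) ≤ K :=
  S.eventually_mul_s_le (C := 2) (by norm_num) (fun r hr => S.deriv_excess_a (by linarith))
    (fun r hr => S.excess_a_nonneg (by linarith)) (fun r hr => by
      have := S.g_div_s_sq_mul_le (r := r) (by linarith)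
      linarith)

theorem monotone_b_div_sqrt_s (S : ReducedExpander a b F A B g c) :
    MonotoneOn (fun r => b r / √(2 * F r + c)) (Ici 0) :=
  S.monotone_div_sqrt_s S.cont_b S.deriv_b S.pos_b fun _ hr => S.excess_b_nonneg hr

/-- The additional source 1/b² is O(1/s) because b/√s is nondecreasing, hence bounded below by its
value at 1. -/
theorem eventually_excess_b_le (S : ReducedExpander a b F A B g c) :
    ∃ K, 0 < K ∧ ∀ᶠ r in atTop, (B r / b r - g r / (2 * F r + c)) * (2 * F r + c) ≤ K := by
  have hw1 : 0 < b 1 / √(2 * F 1 + c) := div_pos (S.pos_b 1 one_pos) (S.sqrt_s_pos zero_le_one)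
  set w₁ := b 1 / √(2 * F 1 + c)
  refine S.eventually_mul_s_le (C := 1 / w₁ ^ 2 + 2) (by positivity)
    (fun r hr => S.deriv_excess_b (by linarith))
    (fun r hr => S.excess_b_nonneg (by linarith)) (fun r hr => ?_)
  have hr0 : 0 < r := by linarith
  have h := S.g_div_s_sq_mul_le hr0
  have hm : w₁ ≤ b r / √(2 * F r + c) :=
    S.monotone_b_div_sqrt_s (mem_Ici.2 zero_le_one) (mem_Ici.2 hr0.le) hr
  have hb := S.pos_b r hr0
  have hσ := S.sqrt_s_pos hr0.le
  have hsq := Real.sq_sqrt (S.s_pos hr0.le).le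
  have : 1 / b r ^ 2 * (2 * F r + c) ≤ 1 / w₁ ^ 2 := by
    have h1 : 1 / b r ^ 2 * (2 * F r + c) = 1 / (b r / √(2 * F r + c)) ^ 2 := by
      rw [div_pow, hsq]; field_simp
    rw [h1]
    gcongr
  nlinarith

/-- It suffices that s - g² is bounded. Its derivative is 2g(1 + Hg - (s - g²)), and Hg is bounded
because the excess bounds give H ≤ 3g/s + O(1/s), while g² ≤ s. -/
theorem tendsto_g_div_sqrt_s (S : ReducedExpander a b F A B g c) :
    Tendsto (fun r => g r / √(2 * F r + c)) atTop (𝓝 1) := by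
  obtain ⟨Ka, hKa, ha⟩ := S.eventually_excess_a_le
  obtain ⟨Kb, hKb, hb⟩ := S.eventually_excess_b_le
  obtain ⟨R, hR⟩ := eventually_atTop.1 (((ha.and hb).and
    (tendsto_atTop.1 S.tendsto_sqrt_s 1)).and (eventually_ge_atTop 1))
  set K := max (2 * F R + c - g R ^ 2) (4 + Ka + 2 * Kb)
  have hbound : ∀ r, R ≤ r → 2 * F r + c - g r ^ 2 ≤ K := by
    refine le_of_deriv_nonpos_above
      (fun r hr => (S.deriv_s (by linarith [(hR r hr).2])).sub
        ((S.deriv_g r (by linarith [(hR r hr).2])).pow 2)) (le_max_left _ _) ?_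
    intro r hr hlt
    obtain ⟨⟨⟨hea, heb⟩, hσ1⟩, hr1⟩ := hR r hr
    have hr0 : 0 < r := by linarith
    have hlt' := (le_max_right _ _).trans_lt hlt
    have hg := S.g_pos hr0
    have hs := S.s_pos hr0.le
    have hgs := S.g_sq_le hr0.le
    have hs1 : 1 ≤ 2 * F r + c := by
      rw [← Real.sq_sqrt hs.le]; nlinarith
    have hgle : g r ≤ 2 * F r + c := by nlinarith
    have hH : (A r / a r + 2 * (B r / b r)) * g r ≤ 3 + Ka + 2 * Kb := by
      generalize 2 * F r + c = s at *
      generalize A r / a r = p at *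
      generalize B r / b r = q at *
      have h1 : (p + 2 * q) * s ≤ 3 * g r + Ka + 2 * Kb := by
        have : g r / s * s = g r := by field_simp
        nlinarith
      have h2 : (p + 2 * q) * g r * s ≤ (3 + Ka + 2 * Kb) * s := by
        nlinarith
      exact le_of_mul_le_mul_right h2 hs
    push_cast
    nlinarith
  have hsq : Tendsto (fun r => (g r / √(2 * F r + c)) ^ 2) atTop (𝓝 1) := by
    have hlow : Tendsto (fun r => 1 - K / (2 * F r + c)) atTop (𝓝 1) := by
      simpa using (tendsto_const_nhds (x := (1 : ℝ))).sub (S.tendsto_s.const_div_atTop K)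
    refine tendsto_of_tendsto_of_tendsto_of_le_of_le' hlow tendsto_const_nhds ?_ ?_
    · filter_upwards [eventually_ge_atTop R] with r hr
      have hr0 : 0 < r := by linarith [(hR r hr).2]
      have hs := S.s_pos hr0.le
      rw [div_pow, Real.sq_sqrt hs.le, one_sub_div hs.ne']
      gcongr
      linarith [hbound r hr]
    · filter_upwards [eventually_ge_atTop R] with r hr
      have hr0 : 0 < r := by linarith [(hR r hr).2]
      have hs := S.s_pos hr0.le
      rw [div_pow, Real.sq_sqrt hs.le]
      exact (div_le_one hs).2 (S.g_sq_le hr0.le)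
  have h := hsq.sqrt
  rw [Real.sqrt_one] at h
  refine h.congr' ?_
  filter_upwards [eventually_ge_atTop 0] with r hr
  exact Real.sqrt_sq (div_nonneg (S.g_nonneg hr) (Real.sqrt_nonneg _))

/-- If the excess `u' / u - g / s` is nonnegative and `O(1 / s)`, then `u'` converges to a
limit bounding the nondecreasing function `u / √s` from above. -/
theorem exists_slope (S : ReducedExpander a b F A B g c)
    {u U : ℝ → ℝ} {K : ℝ} (hK : 0 < K) (hc : ContinuousOn u (Ici 0))
    (hu : ∀ r, 0 < r → HasDerivAt u (U r) r) (hpos : ∀ r, 0 < r → 0 < u r)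
    (he : ∀ r, 0 < r → 0 ≤ U r / u r - g r / (2 * F r + c))
    (hle : ∀ᶠ r in atTop, (U r / u r - g r / (2 * F r + c)) * (2 * F r + c) ≤ K) :
    ∃ l, Tendsto U atTop (𝓝 l) ∧ ∀ r, 0 ≤ r → u r / √(2 * F r + c) ≤ l := by
  obtain ⟨κ, hκ, hg⟩ := S.exists_lower_bound_g
  have hmono := S.monotone_div_sqrt_s hc hu hpos he
  obtain ⟨R, hR⟩ := eventually_atTop.1 (hle.and (eventually_ge_atTop 1))
  have hR1 := (hR R le_rfl).2
  set w : ℝ → ℝ := fun r => u r / √(2 * F r + c) with hw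
  -- The ratio w = u/√s grows at logarithmic rate at most K/s, and (K/κ)/√s decreases at rate at
  -- least K/s since (√s)' ≥ κ. The exponential factor therefore makes the product nonincreasing,
  -- which bounds w.
  have hdw : ∀ r, R ≤ r → HasDerivAt (fun r => -(w r * Real.exp (K / κ * (√(2 * F r + c))⁻¹)))
      (-((U r / u r - g r / (2 * F r + c)) * w r * Real.exp (K / κ * (√(2 * F r + c))⁻¹)
        + w r * (Real.exp (K / κ * (√(2 * F r + c))⁻¹)
          * (K / κ * (-(g r / √(2 * F r + c)) / √(2 * F r + c) ^ 2))))) r := by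
    intro r hr
    have hr0 : 0 < r := by linarith
    exact ((S.deriv_div_sqrt_s hr0 (hu r hr0) (hpos r hr0)).mul
      ((((S.deriv_sqrt_s hr0).inv (S.sqrt_s_pos hr0.le).ne').const_mul (K / κ)).exp)).neg
  have hanti : MonotoneOn (fun r => -(w r * Real.exp (K / κ * (√(2 * F r + c))⁻¹))) (Ici R) := by
    refine monotoneOn_Ici_of_hasDerivAt (fun r hr => (hdw r hr).continuousAt.continuousWithinAt)
      (fun r hr => hdw r hr.le) ?_
    intro r hr
    obtain ⟨hKr, hr1⟩ := hR r hr.le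
    have hr0 : 0 < r := by linarith
    have hσ := S.sqrt_s_pos hr0.le
    have hs := S.s_pos hr0.le
    have hsq := Real.sq_sqrt hs.le
    have hwr : 0 < w r := div_pos (hpos r hr0) hσ
    have hκg := hg r hr1
    have h1 : U r / u r - g r / (2 * F r + c) ≤ K / (2 * F r + c) := (le_div_iff₀ hs).2 hKr
    have h2 : K / (2 * F r + c) ≤ K / κ * ((g r / √(2 * F r + c)) / √(2 * F r + c) ^ 2) := by
      rw [hsq]
      have : κ ≤ g r / √(2 * F r + c) := (le_div_iff₀ hσ).2 hκg
      calc K / (2 * F r + c) = K / κ * (κ / (2 * F r + c)) := by field_simp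
        _ ≤ _ := by gcongr
    have h3 := mul_nonneg (sub_nonneg.2 (h1.trans h2))
      (mul_nonneg hwr.le (Real.exp_nonneg (K / κ * (√(2 * F r + c))⁻¹)))
    rw [neg_div]
    nlinarith
  have hbdd : ∀ r, R ≤ r → w r ≤ w R * Real.exp (K / κ * (√(2 * F R + c))⁻¹) := by
    intro r hr
    have hr0 : 0 < r := by linarith
    have h := hanti (mem_Ici.2 le_rfl) (mem_Ici.2 hr) hr
    have hσ := S.sqrt_s_pos hr0.le
    have hwr : 0 < w r := div_pos (hpos r hr0) hσ
    have h1 : 1 ≤ Real.exp (K / κ * (√(2 * F r + c))⁻¹) := Real.one_le_exp (by positivity)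
    simp only at h
    nlinarith
  have hmono' : Monotone fun r => w (max r R) := fun x y hxy =>
    hmono (mem_Ici.2 (by linarith [le_max_right x R])) (mem_Ici.2 (by linarith [le_max_right y R]))
      (max_le_max_right R hxy)
  have hlim' := tendsto_atTop_ciSup hmono' ⟨_, by
    rintro _ ⟨r, rfl⟩
    exact hbdd _ (le_max_right r R)⟩
  set l := ⨆ r, w (max r R)
  have hlim : Tendsto w atTop (𝓝 l) := by
    refine hlim'.congr' ?_
    filter_upwards [eventually_ge_atTop R] with r hr
    rw [max_eq_left hr]
  refine ⟨l, ?_, fun r hr => ge_of_tendsto hlim ?_⟩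
  · have hinv : Tendsto (fun r => (√(2 * F r + c))⁻¹) atTop (𝓝 0) :=
      tendsto_inv_atTop_zero.comp S.tendsto_sqrt_s
    have hsmall : Tendsto (fun r => (U r / u r - g r / (2 * F r + c)) * (2 * F r + c) * w r
        * (√(2 * F r + c))⁻¹) atTop (𝓝 0) := by
      have hup : Tendsto (fun r => K * w r * (√(2 * F r + c))⁻¹) atTop (𝓝 0) := by
        simpa using (hlim.const_mul K).mul hinv
      refine tendsto_of_tendsto_of_tendsto_of_le_of_le' tendsto_const_nhds hup ?_ ?_
      · filter_upwards [eventually_gt_atTop 0] with r hr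
        have hs := S.s_pos hr.le
        have hwr : 0 < w r := div_pos (hpos r hr) (S.sqrt_s_pos hr.le)
        have := he r hr
        positivity
      · filter_upwards [hle, eventually_gt_atTop 0] with r hr hr0
        have hwr : 0 < w r := div_pos (hpos r hr0) (S.sqrt_s_pos hr0.le)
        gcongr
    -- Exact decomposition: u' = (g/√s)·w + (excess·s)·w/√s, where only the first term survives in
    -- the limit.
    have hsum := (S.tendsto_g_div_sqrt_s.mul hlim).add hsmall
    rw [one_mul, add_zero] at hsum
    refine hsum.congr' ?_
    filter_upwards [eventually_gt_atTop 0] with r hr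
    have hσ := S.sqrt_s_pos hr.le
    have hsq := Real.sq_sqrt (S.s_pos hr.le).le
    have hur := hpos r hr
    simp only [hw]
    generalize √(2 * F r + c) = σ at *
    rw [← hsq]
    field_simp
    ring
  · filter_upwards [eventually_ge_atTop r] with x hx
    exact hmono (mem_Ici.2 hr) (mem_Ici.2 (hr.trans hx)) hx

theorem exists_slope_a (S : ReducedExpander a b F A B g c) :
    ∃ l, Tendsto A atTop (𝓝 l) ∧ ∀ r, 0 ≤ r → a r / √(2 * F r + c) ≤ l := by
  obtain ⟨K, hK, h⟩ := S.eventually_excess_a_le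
  exact S.exists_slope hK S.cont_a S.deriv_a S.pos_a (fun _ hr => S.excess_a_nonneg hr) h

theorem exists_slope_b (S : ReducedExpander a b F A B g c) :
    ∃ l, Tendsto B atTop (𝓝 l) ∧ ∀ r, 0 ≤ r → b r / √(2 * F r + c) ≤ l := by
  obtain ⟨K, hK, h⟩ := S.eventually_excess_b_le
  exact S.exists_slope hK S.cont_b S.deriv_b S.pos_b (fun _ hr => S.excess_b_nonneg hr) h

/-! ### Estimates on [0, 1] for the collapsing factor. -/

theorem one_le_exp_F (S : ReducedExpander a b F A B g c)
    {r : ℝ} (hr : 0 ≤ r) : 1 ≤ Real.exp (F r) := Real.one_le_exp (S.F_nonneg hr)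

/-- A b² e^F is the integral of the nondecreasing function a b² e^F from 0, hence at most r times
its value at r. -/
theorem A_le_mul_a (S : ReducedExpander a b F A B g c)
    (h0 : A 0 * b 0 = 0) {r : ℝ} (hr : 0 < r) : A r ≤ r * a r := by
  have hm := monotoneOn_Ici_of_hasDerivAt (r₀ := 0)
    (u := fun r => r * (a r * b r ^ 2 * Real.exp (F r)) - A r * b r ^ 2 * Real.exp (F r))
    (u' := fun r => r * (A r * b r ^ 2 * Real.exp (F r) + 2 * (a r * b r * B r * Real.exp (F r))
      + a r * b r ^ 2 * (Real.exp (F r) * g r)))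
    ((continuousOn_id.mul ((S.cont_a.mul (S.cont_b.pow 2)).mul S.cont_exp)).sub
      ((S.cont_A.mul (S.cont_b.pow 2)).mul S.cont_exp))
    (fun r hr => by
      refine (((hasDerivAt_id r).mul (((S.deriv_a r hr).mul ((S.deriv_b r hr).pow 2)).mul
        (S.deriv_exp hr))).sub (S.deriv_weighted_A hr)).congr_deriv ?_
      simp only [Pi.mul_apply, Pi.pow_apply, id]
      push_cast
      ring)
    (fun r hr => by
      have := S.A_pos hr; have := S.B_pos hr; have := S.pos_a r hr; have := S.pos_b r hr
      have := S.g_pos hr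
      positivity)
  have h := hm (mem_Ici.2 le_rfl) (mem_Ici.2 hr.le) hr.le
  have h00 : A 0 * b 0 ^ 2 = 0 := by rw [sq, ← mul_assoc, h0, zero_mul]
  simp only [h00, zero_mul, sub_zero] at h
  have hb := S.pos_b r hr
  have h1 : 0 ≤ (r * a r - A r) * (b r ^ 2 * Real.exp (F r)) := by linarith
  linarith [nonneg_of_mul_nonneg_left h1 (by positivity)]

/-- Integrates (log a)' ≤ r. It controls a(1)/a(0) with no dependence on a(0). -/
theorem a_one_le (S : ReducedExpander a b F A B g c)
    (h0 : A 0 * b 0 = 0) : a 1 ≤ a 0 * Real.exp (1 / 2) := by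
  have hm := monotoneOn_Ici_of_hasDerivAt (r₀ := 0)
    (u := fun r => -(a r * Real.exp (-(r ^ 2 / 2))))
    (u' := fun r => (r * a r - A r) * Real.exp (-(r ^ 2 / 2)))
    ((S.cont_a.mul (by fun_prop)).neg)
    (fun r hr => by
      have he : HasDerivAt (fun r : ℝ => Real.exp (-(r ^ 2 / 2))) (Real.exp (-(r ^ 2 / 2)) * (-r)) r :=
        ((((hasDerivAt_id r).pow 2).div_const 2).neg).exp.congr_deriv (by simp)
      exact (((S.deriv_a r hr).mul he).neg).congr_deriv (by ring))
    (fun r hr => mul_nonneg (sub_nonneg.2 (S.A_le_mul_a h0 hr)) (Real.exp_nonneg _))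
  have h := hm (mem_Ici.2 le_rfl) (mem_Ici.2 zero_le_one) zero_le_one
  have h2 : a 1 * Real.exp (-(1 / 2)) ≤ a 0 := by
    norm_num at h ⊢
    exact h
  rwa [Real.exp_neg, ← div_eq_mul_inv, div_le_iff₀ (Real.exp_pos _)] at h2

theorem mul_a_zero_le (S : ReducedExpander a b F A B g c)
    {r : ℝ} (hr : 0 ≤ r) : r * a 0 ≤ B r * b r * a r * Real.exp (F r) := by
  have hm := monotoneOn_Ici_of_hasDerivAt (r₀ := 0)
    (u := fun r => B r * b r * a r * Real.exp (F r) - r * a 0)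
    (u' := fun r => a r * (1 + b r ^ 2) * Real.exp (F r) - a 0)
    ((((S.cont_B.mul S.cont_b).mul S.cont_a).mul S.cont_exp).sub (by fun_prop))
    (fun r hr => ((S.deriv_weighted_B hr).sub ((hasDerivAt_id r).mul_const (a 0))).congr_deriv
      (by simp))
    (fun r hr => by
      have h1 := S.one_le_exp_F hr.le
      have h2 := S.monotone_a (mem_Ici.2 le_rfl) (mem_Ici.2 hr.le) hr.le
      have h3 := S.pos_a r hr
      have h4 : 1 ≤ (1 + b r ^ 2) * Real.exp (F r) := by nlinarith [sq_nonneg (b r)]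
      nlinarith)
  have h := hm (mem_Ici.2 le_rfl) (mem_Ici.2 hr) hr
  simp only [S.B_mul_zero, zero_mul, sub_zero] at h
  linarith

/-- Lower bound for `b 1` when the sphere `S²` collapses at the origin. -/
theorem exp_le_b_one (S : ReducedExpander a b F A B g c)
    (h0 : A 0 * b 0 = 0) : Real.exp (-1 - F 1) ≤ b 1 := by
  have ha1 := S.pos_a 1 one_pos
  -- Replacing a and e^F by their maxima on [0, 1] in `mul_a_zero_le` gives b b' ≥ κr, hence b² ≥
  -- κr².
  set κ := a 0 / (a 1 * Real.exp (F 1)) with hκ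
  have hm := monotoneOn_Icc_of_hasDerivAt (r₀ := 0) (r₁ := 1)
    (u := fun r => b r ^ 2 - κ * r ^ 2) (u' := fun r => 2 * (B r * b r - κ * r))
    (((S.cont_b.pow 2).mono Icc_subset_Ici_self).sub (by fun_prop))
    (fun r hr => (((S.deriv_b r hr.1).pow 2).sub
      (((hasDerivAt_id r).pow 2).const_mul κ)).congr_deriv (by
        simp only [id]; push_cast; ring))
    (fun r hr => by
      have hr0 : 0 < r := hr.1
      have h := S.mul_a_zero_le hr0.le
      have h1 := S.monotone_a (mem_Ici.2 hr0.le) (mem_Ici.2 zero_le_one) hr.2.le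
      have h2 := Real.exp_le_exp.2
        (S.monotone_F (mem_Ici.2 hr0.le) (mem_Ici.2 zero_le_one) hr.2.le)
      have hB := S.B_pos hr0
      have hb := S.pos_b r hr0
      have h3 : r * a 0 ≤ B r * b r * (a 1 * Real.exp (F 1)) := by
        refine h.trans ?_
        rw [mul_assoc (B r * b r)]
        gcongr
      have h4 : κ * r ≤ B r * b r := by
        rw [hκ, div_mul_eq_mul_div, div_le_iff₀ (by positivity)]
        linarith
      linarith)
  have h := hm ⟨le_rfl, zero_le_one⟩ ⟨zero_le_one, le_rfl⟩ zero_le_one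
  simp only at h
  have hκle : Real.exp (-1 / 2 - F 1) ≤ κ := by
    rw [hκ, le_div_iff₀ (by positivity)]
    have h1 := S.a_one_le h0
    calc Real.exp (-1 / 2 - F 1) * (a 1 * Real.exp (F 1))
        = a 1 * Real.exp (-1 / 2) := by
          rw [show Real.exp (-1 / 2) = Real.exp (-1 / 2 - F 1) * Real.exp (F 1) by
            rw [← Real.exp_add]; ring_nf]
          ring
      _ ≤ a 0 * Real.exp (1 / 2) * Real.exp (-1 / 2) := by gcongr
      _ = a 0 := by rw [mul_assoc, ← Real.exp_add]; norm_num
  have hF := S.F_nonneg zero_le_one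
  refine le_of_sq_le_sq ?_ (S.pos_b 1 one_pos).le
  -- Deliberately lossy, using F ≥ 0, to reach the form exp(-1 - F(1)) shared by both topologies.
  calc Real.exp (-1 - F 1) ^ 2 = Real.exp (2 * (-1 - F 1)) := by
        rw [← Real.exp_nat_mul]; norm_num
    _ ≤ Real.exp (-1 / 2 - F 1) := Real.exp_le_exp.2 (by linarith)
    _ ≤ b 1 ^ 2 := by nlinarith [sq_nonneg (b 0)]

theorem B_mul_b_le (S : ReducedExpander a b F A B g c)
    {r : ℝ} (hr : 0 < r) : B r * b r ≤ r * (1 + b r ^ 2) := by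
  have hm := monotoneOn_Ici_of_hasDerivAt (r₀ := 0)
    (u := fun r => r * (a r * (1 + b r ^ 2) * Real.exp (F r)) - B r * b r * a r * Real.exp (F r))
    (u' := fun r => r * (A r * (1 + b r ^ 2) * Real.exp (F r)
      + 2 * (a r * b r * B r * Real.exp (F r))
      + a r * (1 + b r ^ 2) * (Real.exp (F r) * g r)))
    ((continuousOn_id.mul ((S.cont_a.mul (continuousOn_const.add (S.cont_b.pow 2))).mul
      S.cont_exp)).sub (((S.cont_B.mul S.cont_b).mul S.cont_a).mul S.cont_exp))
    (fun r hr => by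
      refine (((hasDerivAt_id r).mul (((S.deriv_a r hr).mul (((S.deriv_b r hr).pow 2).const_add 1)).mul
        (S.deriv_exp hr))).sub (S.deriv_weighted_B hr)).congr_deriv ?_
      simp only [Pi.mul_apply, Pi.pow_apply, id]
      push_cast
      ring)
    (fun r hr => by
      have := S.A_pos hr; have := S.B_pos hr; have := S.pos_a r hr; have := S.pos_b r hr
      have := S.g_pos hr
      positivity)
  have h := hm (mem_Ici.2 le_rfl) (mem_Ici.2 hr.le) hr.le
  simp only [S.B_mul_zero, zero_mul, sub_zero] at h
  have ha := S.pos_a r hr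
  have h1 : 0 ≤ (r * (1 + b r ^ 2) - B r * b r) * (a r * Real.exp (F r)) := by linarith
  linarith [nonneg_of_mul_nonneg_left h1 (by positivity)]

/-- Grönwall for 1 + b², whose logarithmic derivative is at most 2r by `B_mul_b_le`. -/
theorem b_one_sq_le (S : ReducedExpander a b F A B g c) :
    1 + b 1 ^ 2 ≤ (1 + b 0 ^ 2) * Real.exp 1 := by
  have hm := monotoneOn_Ici_of_hasDerivAt (r₀ := 0)
    (u := fun r => -((1 + b r ^ 2) * Real.exp (-(r ^ 2))))
    (u' := fun r => 2 * (r * (1 + b r ^ 2) - B r * b r) * Real.exp (-(r ^ 2)))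
    (((continuousOn_const.add (S.cont_b.pow 2)).mul (by fun_prop)).neg)
    (fun r hr => by
      have he : HasDerivAt (fun r : ℝ => Real.exp (-(r ^ 2))) (Real.exp (-(r ^ 2)) * (-(2 * r))) r :=
        (((hasDerivAt_id r).pow 2).neg).exp.congr_deriv (by simp)
      refine (((((S.deriv_b r hr).pow 2).const_add 1).mul he).neg).congr_deriv ?_
      simp only [Pi.pow_apply]
      push_cast
      ring)
    (fun r hr => mul_nonneg (mul_nonneg zero_le_two (sub_nonneg.2 (S.B_mul_b_le hr)))
      (Real.exp_nonneg _))
  have h := hm (mem_Ici.2 le_rfl) (mem_Ici.2 zero_le_one) zero_le_one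
  have h2 : (1 + b 1 ^ 2) * Real.exp (-1) ≤ 1 + b 0 ^ 2 := by
    norm_num at h ⊢
    linarith
  rwa [Real.exp_neg, ← div_eq_mul_inv, div_le_iff₀ (Real.exp_pos _)] at h2

/-- Lower bound for `a 1` when the circle `S¹` collapses at the origin. -/
theorem exp_le_a_one (S : ReducedExpander a b F A B g c)
    (hA0 : A 0 = 1) (ha0 : 0 ≤ a 0) :
    b 0 ^ 2 / (1 + b 0 ^ 2) * Real.exp (-1 - F 1) ≤ a 1 := by
  have hb1 := S.pos_b 1 one_pos
  -- The nondecreasing quantity A b² e^F starts at b(0)²; bounding b and F by their values at 1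
  -- gives a' ≥ κ on [0, 1].
  set κ := b 0 ^ 2 / (b 1 ^ 2 * Real.exp (F 1)) with hκ
  have hmA := monotoneOn_Ici_of_hasDerivAt ((S.cont_A.mul (S.cont_b.pow 2)).mul S.cont_exp)
    (fun r hr => S.deriv_weighted_A hr) (fun r hr => by
      have := S.pos_a r hr; positivity)
  have hm := monotoneOn_Icc_of_hasDerivAt (r₀ := 0) (r₁ := 1)
    (u := fun r => a r - κ * r) (u' := fun r => A r - κ * 1)
    ((S.cont_a.mono Icc_subset_Ici_self).sub (by fun_prop))
    (fun r hr => (S.deriv_a r hr.1).sub ((hasDerivAt_id r).const_mul κ))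
    (fun r hr => by
      have hr0 : 0 < r := hr.1
      have h := hmA (mem_Ici.2 le_rfl) (mem_Ici.2 hr0.le) hr0.le
      simp only [Pi.mul_apply, Pi.pow_apply, hA0, S.F_zero, Real.exp_zero, one_mul, mul_one] at h
      have h1 := S.monotone_b (mem_Ici.2 hr0.le) (mem_Ici.2 zero_le_one) hr.2.le
      have h2 := Real.exp_le_exp.2
        (S.monotone_F (mem_Ici.2 hr0.le) (mem_Ici.2 zero_le_one) hr.2.le)
      have hA := S.A_pos hr0
      have hb := S.pos_b r hr0
      rw [mul_one, sub_nonneg, hκ, div_le_iff₀ (by positivity)]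
      refine h.trans ?_
      rw [mul_assoc]
      gcongr)
  have h := hm ⟨le_rfl, zero_le_one⟩ ⟨zero_le_one, le_rfl⟩ zero_le_one
  simp only [mul_zero, mul_one, sub_zero] at h
  have hκle : b 0 ^ 2 / (1 + b 0 ^ 2) * Real.exp (-1 - F 1) ≤ κ := by
    have h1 := S.b_one_sq_le
    have he : Real.exp (-1 - F 1) = 1 / (Real.exp 1 * Real.exp (F 1)) := by
      rw [← Real.exp_add, one_div, ← Real.exp_neg]; ring_nf
    rw [he, div_mul_div_comm, mul_one, hκ, ← mul_assoc]
    gcongr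
    linarith
  linarith

end ReducedExpander

/-! ### Divergence along a sequence. -/

/-- Meant for values at r = 1. The squeeze on s also forces F = (s - c)/2 → 0, so the lower bound on
x does not degenerate while √s → 0. -/
theorem tendsto_atTop_of_collapsing {ι : Type*} {l : Filter ι} {K : ℝ} (hK : 0 < K)
    {c s F x L : ι → ℝ} (hlim : Tendsto c l (𝓝 0))
    (hs : ∀ i, s i = 2 * F i + c i) (hspos : ∀ i, 0 < s i)
    (hle : ∀ i, s i ≤ c i * Real.exp 2)
    (hx : ∀ i, K * Real.exp (-1 - F i) ≤ x i) (hL : ∀ i, x i / √(s i) ≤ L i) :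
    Tendsto L l atTop := by
  have hs0 : Tendsto s l (𝓝 0) :=
    squeeze_zero (fun i => (hspos i).le) hle (by simpa using hlim.mul_const (Real.exp 2))
  have hsq : Tendsto (fun i => √(s i)) l (𝓝[>] 0) := by
    refine tendsto_nhdsWithin_iff.2 ⟨by simpa using hs0.sqrt, ?_⟩
    exact Eventually.of_forall fun i => Real.sqrt_pos.2 (hspos i)
  have hF : Tendsto F l (𝓝 0) := by
    have h := (hs0.sub hlim).div_const 2
    simp only [sub_zero, zero_div] at h
    exact h.congr fun i => by rw [hs i]; ring
  have hnum : Tendsto (fun i => K * Real.exp (-1 - F i)) l (𝓝 (K * Real.exp (-1 - 0))) :=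
    ((Real.continuous_exp.tendsto _).comp (hF.const_sub (-1))).const_mul K
  refine tendsto_atTop_mono (fun i => ?_)
    (hnum.pos_mul_atTop (by positivity) (tendsto_inv_nhdsGT_zero.comp hsq))
  refine le_trans ?_ (hL i)
  rw [Function.comp_apply, ← div_eq_mul_inv]
  exact div_le_div_of_nonneg_right (hx i) (Real.sqrt_nonneg _)

theorem tendsto_div_sqrt_atTop {ι : Type*} {l : Filter ι} {K : ℝ} (hK : 0 < K)
    {c x L : ι → ℝ} (hc : ∀ i, 0 < c i) (hlim : Tendsto c l (𝓝 0))
    (hx : ∀ i, K ≤ x i) (hL : ∀ i, x i / √(c i) ≤ L i) : Tendsto L l atTop := by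
  have hsq : Tendsto (fun i => √(c i)) l (𝓝[>] 0) := by
    refine tendsto_nhdsWithin_iff.2 ⟨by simpa using hlim.sqrt, ?_⟩
    exact Eventually.of_forall fun i => Real.sqrt_pos.2 (hc i)
  refine tendsto_atTop_mono (fun i => ?_)
    ((tendsto_inv_nhdsGT_zero.comp hsq).const_mul_atTop hK)
  refine le_trans ?_ (hL i)
  rw [Function.comp_apply, ← div_eq_mul_inv]
  exact div_le_div_of_nonneg_right (hx i) (Real.sqrt_nonneg _)

/-! ### One-sided calculus at the origin. -/

theorem contDiffOn_D1 {u : ℝ → ℝ} (h : ContDiffOn ℝ ∞ u (Ici 0)) :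
    ContDiffOn ℝ ∞ (D1 u) (Ici 0) :=
  h.derivWithin (uniqueDiffOn_Ici 0) (by simp)

theorem hasDerivWithinAt_D1 {u : ℝ → ℝ} (h : ContDiffOn ℝ ∞ u (Ici 0)) {r : ℝ} (hr : 0 ≤ r) :
    HasDerivWithinAt u (D1 u r) (Ici 0) r :=
  (h.differentiableOn (by simp) r hr).hasDerivWithinAt

theorem hasDerivAt_D1 {u : ℝ → ℝ} (h : ContDiffOn ℝ ∞ u (Ici 0)) {r : ℝ} (hr : 0 < r) :
    HasDerivAt u (D1 u r) r :=
  (hasDerivWithinAt_D1 h hr.le).hasDerivAt (Ici_mem_nhds hr)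

theorem tendsto_nhdsGT_zero {u : ℝ → ℝ} (h : ContinuousOn u (Ici 0)) :
    Tendsto u (𝓝[>] 0) (𝓝 (u 0)) :=
  (h 0 (mem_Ici.2 le_rfl)).mono_left (nhdsWithin_mono _ Ioi_subset_Ici_self)

theorem tendsto_div_id {u : ℝ → ℝ} (h : ContDiffOn ℝ ∞ u (Ici 0)) (h0 : u 0 = 0) :
    Tendsto (fun r => u r / r) (𝓝[>] 0) (𝓝 (D1 u 0)) := by
  have h1 := (hasDerivWithinAt_iff_tendsto_slope' (by simp)).1
    ((hasDerivWithinAt_D1 h le_rfl).mono Ioi_subset_Ici_self)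
  refine h1.congr fun r => ?_
  simp [slope_def_field, h0]

/-- Quotient rule at the origin for two functions vanishing there. -/
theorem tendsto_div_of_zero {u v : ℝ → ℝ} (hu : ContDiffOn ℝ ∞ u (Ici 0))
    (hv : ContDiffOn ℝ ∞ v (Ici 0)) (hu0 : u 0 = 0) (hv0 : v 0 = 0) (hv' : D1 v 0 ≠ 0) :
    Tendsto (fun r => u r / v r) (𝓝[>] 0) (𝓝 (D1 u 0 / D1 v 0)) := by
  refine ((tendsto_div_id hu hu0).div (tendsto_div_id hv hv0) hv').congr' ?_
  filter_upwards [self_mem_nhdsWithin] with r hr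
  exact div_div_div_cancel_right₀ (ne_of_gt hr) _ _

/-! ### The first integral and reduction to the first-order system. -/

namespace IsExpandingSolitonProfile

variable {a b f : ℝ → ℝ}

theorem D2_f_eq (P : IsExpandingSolitonProfile a b f)
    {r : ℝ} (hr : 0 < r) :
    D2 f r = 2 + 2 / b r ^ 2 - 2 * (D1 b r / b r) ^ 2 - 4 * (D1 a r / a r) * (D1 b r / b r)
      + (D1 a r / a r + 2 * (D1 b r / b r)) * D1 f r := by
  have ha := (P.pos_a r hr).ne'
  have hb := (P.pos_b r hr).ne'
  rw [P.eq_f r hr, P.eq_a r hr, P.eq_b r hr]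
  field_simp
  ring

theorem deriv_logA (P : IsExpandingSolitonProfile a b f)
    {r : ℝ} (hr : 0 < r) :
    HasDerivAt (fun r => D1 a r / a r)
      (1 - (D1 a r / a r + 2 * (D1 b r / b r) - D1 f r) * (D1 a r / a r)) r := by
  have ha := (P.pos_a r hr).ne'
  have hb := (P.pos_b r hr).ne'
  have hA : HasDerivAt (D1 a) (D2 a r) r := hasDerivAt_D1 (contDiffOn_D1 P.smooth_a) hr
  refine (hA.div (hasDerivAt_D1 P.smooth_a hr) ha).congr_deriv ?_
  rw [P.eq_a r hr]
  field_simp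
  ring

theorem deriv_logB (P : IsExpandingSolitonProfile a b f)
    {r : ℝ} (hr : 0 < r) :
    HasDerivAt (fun r => D1 b r / b r)
      (1 + 1 / b r ^ 2 - (D1 a r / a r + 2 * (D1 b r / b r) - D1 f r) * (D1 b r / b r)) r := by
  have ha := (P.pos_a r hr).ne'
  have hb := (P.pos_b r hr).ne'
  have hB : HasDerivAt (D1 b) (D2 b r) r := hasDerivAt_D1 (contDiffOn_D1 P.smooth_b) hr
  refine (hB.div (hasDerivAt_D1 P.smooth_b hr) hb).congr_deriv ?_
  rw [P.eq_b r hr]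
  field_simp
  ring

theorem deriv_inv_sq (P : IsExpandingSolitonProfile a b f)
    {r : ℝ} (hr : 0 < r) :
    HasDerivAt (fun r => 2 / b r ^ 2) (-(4 * (D1 b r / b r) / b r ^ 2)) r := by
  have hb := (P.pos_b r hr).ne'
  refine ((hasDerivAt_const r (2 : ℝ)).div ((hasDerivAt_D1 P.smooth_b hr).pow 2)
    (pow_ne_zero 2 hb)).congr_deriv ?_
  simp only [Pi.pow_apply]
  field_simp
  push_cast
  ring

/-- Here f'' has been eliminated through `D2_f_eq`, so only first derivatives occur and no third
derivative of f is needed. -/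
theorem deriv_firstIntegral (P : IsExpandingSolitonProfile a b f)
    {r : ℝ} (hr : 0 < r) :
    HasDerivAt (fun r => 2 + 2 / b r ^ 2 - 2 * (D1 b r / b r) ^ 2
        - 4 * ((D1 a r / a r) * (D1 b r / b r))
        + 2 * ((D1 a r / a r + 2 * (D1 b r / b r)) * D1 f r) - D1 f r ^ 2 - 2 * f r) 0 r := by
  have hf : HasDerivAt (D1 f) (D2 f r) r := hasDerivAt_D1 (contDiffOn_D1 P.smooth_f) hr
  rw [P.D2_f_eq hr] at hf
  have hp := P.deriv_logA hr
  have hq := P.deriv_logB hr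
  refine (((((((P.deriv_inv_sq hr).const_add 2).sub ((hq.pow 2).const_mul 2)).sub
    ((hp.mul hq).const_mul 4)).add (((hp.add (hq.const_mul 2)).mul hf).const_mul 2)).sub
    (hf.pow 2)).sub ((hasDerivAt_D1 P.smooth_f hr).const_mul 2)).congr_deriv ?_
  simp only [Pi.add_apply]
  push_cast
  ring

/-- The first integral of the soliton equations, with its constant read off at the origin. -/
theorem firstIntegral (P : IsExpandingSolitonProfile a b f)
    {k : ℝ}
    (hlim : Tendsto (fun r => (D1 a r / a r + 2 * (D1 b r / b r)) * D1 f r) (𝓝[>] 0)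
      (𝓝 (k - D2 f 0))) {r : ℝ} (hr : 0 < r) :
    D2 f r + (D1 a r / a r + 2 * (D1 b r / b r)) * D1 f r - D1 f r ^ 2 - 2 * f r = k := by
  set Q : ℝ → ℝ := fun r =>
    D2 f r + (D1 a r / a r + 2 * (D1 b r / b r)) * D1 f r - D1 f r ^ 2 - 2 * f r with hQ
  have hQd : ∀ x ∈ Ioi (0 : ℝ), HasDerivAt Q 0 x := by
    intro x hx
    refine (P.deriv_firstIntegral hx).congr_of_eventuallyEq ?_
    filter_upwards [Ioi_mem_nhds hx] with y hy
    simp only [hQ, P.D2_f_eq hy]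
    ring
  have hconst : ∀ x ∈ Ioi (0 : ℝ), Q x = Q r := fun x hx =>
    isOpen_Ioi.is_const_of_deriv_eq_zero isPreconnected_Ioi
      (fun y hy => (hQd y hy).differentiableAt.differentiableWithinAt)
      (fun y hy => (hQd y hy).deriv) hx hr
  have h1 := contDiffOn_D1 P.smooth_f
  have h2 : Tendsto (D2 f) (𝓝[>] 0) (𝓝 (D2 f 0)) :=
    tendsto_nhdsGT_zero (contDiffOn_D1 h1).continuousOn
  have hQ0 : Tendsto Q (𝓝[>] 0) (𝓝 k) := by
    have h := ((h2.add hlim).sub ((tendsto_nhdsGT_zero h1.continuousOn).pow 2)).sub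
      ((tendsto_nhdsGT_zero P.smooth_f.continuousOn).const_mul 2)
    simpa [P.f'_zero, P.f_zero] using h
  refine tendsto_nhds_unique (tendsto_const_nhds.congr' ?_) hQ0
  filter_upwards [self_mem_nhdsWithin] with x hx
  exact (hconst x hx).symm

theorem reducedExpander (P : IsExpandingSolitonProfile a b f)
    {c : ℝ} (hc : 0 < c)
    (hlim : Tendsto (fun r => (D1 a r / a r + 2 * (D1 b r / b r)) * D1 f r) (𝓝[>] 0)
      (𝓝 (-c - D2 f 0))) (hA0 : 0 ≤ D1 a 0) (hB0 : D1 b 0 * b 0 = 0) :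
    ReducedExpander a b (fun r => -f r) (D1 a) (D1 b) (fun r => -D1 f r) c where
  c_pos := hc
  cont_a := P.smooth_a.continuousOn
  cont_b := P.smooth_b.continuousOn
  cont_F := P.smooth_f.continuousOn.neg
  cont_A := (contDiffOn_D1 P.smooth_a).continuousOn
  cont_B := (contDiffOn_D1 P.smooth_b).continuousOn
  cont_g := (contDiffOn_D1 P.smooth_f).continuousOn.neg
  pos_a := P.pos_a
  pos_b := P.pos_b
  deriv_a _ hr := hasDerivAt_D1 P.smooth_a hr
  deriv_b _ hr := hasDerivAt_D1 P.smooth_b hr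
  deriv_F _ hr := (hasDerivAt_D1 P.smooth_f hr).neg
  deriv_A r hr := (hasDerivAt_D1 (contDiffOn_D1 P.smooth_a) hr).congr_deriv (by
    rw [show D1 (D1 a) r = D2 a r from rfl, P.eq_a r hr]; ring)
  deriv_B r hr := (hasDerivAt_D1 (contDiffOn_D1 P.smooth_b) hr).congr_deriv (by
    rw [show D1 (D1 b) r = D2 b r from rfl, P.eq_b r hr]; ring)
  deriv_g r hr := (hasDerivAt_D1 (contDiffOn_D1 P.smooth_f) hr).neg.congr_deriv (by
    have h := P.firstIntegral hlim hr
    rw [show D1 (D1 f) r = D2 f r from rfl]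
    linarith)
  F_zero := by simp [P.f_zero]
  g_zero := by simp [P.f'_zero]
  A_zero_nonneg := hA0
  B_mul_zero := hB0

end IsExpandingSolitonProfile

/-- Near the origin b ~ r and f' ~ f₀r, so 2(b'/b)f' → 2f₀ and (a'/a)f' → 0; adding f''(0) = f₀
gives the constant 3f₀ = -c. -/
theorem IsSolitonS1R3.reducedExpander {a b f : ℝ → ℝ} {a₀ f₀ : ℝ}
    (P : IsSolitonS1R3 a b f a₀ f₀) (ha : 0 < a₀) (hf : f₀ < 0) :
    ReducedExpander a b (fun r => -f r) (D1 a) (D1 b) (fun r => -D1 f r) (-3 * f₀) := by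
  refine P.toIsExpandingSolitonProfile.reducedExpander (by linarith) ?_ P.a'_zero.ge
    (by rw [P.b_zero, mul_zero])
  have h1 := contDiffOn_D1 P.smooth_f
  have hq : Tendsto (fun r => D1 f r / b r) (𝓝[>] 0) (𝓝 (D2 f 0 / D1 b 0)) :=
    tendsto_div_of_zero h1 P.smooth_b P.f'_zero P.b_zero (by rw [P.b'_zero]; exact one_ne_zero)
  have hp := (tendsto_nhdsGT_zero (contDiffOn_D1 P.smooth_a).continuousOn).div
    (tendsto_nhdsGT_zero P.smooth_a.continuousOn) (by rw [P.a_zero]; exact ha.ne')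
  have hB := tendsto_nhdsGT_zero (contDiffOn_D1 P.smooth_b).continuousOn
  have h := (hp.mul (tendsto_nhdsGT_zero h1.continuousOn)).add ((hB.mul hq).const_mul 2)
  rw [P.f'_zero, P.b'_zero, P.f''_zero] at h
  rw [P.f''_zero]
  convert h using 2
  · simp only [Pi.div_apply]; ring
  · ring

/-- Now only (a'/a)f' contributes in the limit, with value f₀, so the constant is 2f₀ = -c. -/
theorem IsSolitonS2R2.reducedExpander {a b f : ℝ → ℝ} {b₀ f₀ : ℝ}
    (P : IsSolitonS2R2 a b f b₀ f₀) (hb : 0 < b₀) (hf : f₀ < 0) :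
    ReducedExpander a b (fun r => -f r) (D1 a) (D1 b) (fun r => -D1 f r) (-2 * f₀) := by
  refine P.toIsExpandingSolitonProfile.reducedExpander (by linarith) ?_
    (by rw [P.a'_zero]; exact zero_le_one) (by rw [P.b'_zero, zero_mul])
  have h1 := contDiffOn_D1 P.smooth_f
  have hp : Tendsto (fun r => D1 f r / a r) (𝓝[>] 0) (𝓝 (D2 f 0 / D1 a 0)) :=
    tendsto_div_of_zero h1 P.smooth_a P.f'_zero P.a_zero (by rw [P.a'_zero]; exact one_ne_zero)
  have hq := (tendsto_nhdsGT_zero (contDiffOn_D1 P.smooth_b).continuousOn).div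
    (tendsto_nhdsGT_zero P.smooth_b.continuousOn) (by rw [P.b_zero]; exact hb.ne')
  have hA := tendsto_nhdsGT_zero (contDiffOn_D1 P.smooth_a).continuousOn
  have h := (hA.mul hp).add ((hq.mul (tendsto_nhdsGT_zero h1.continuousOn)).const_mul 2)
  rw [P.f'_zero, P.a'_zero, P.f''_zero] at h
  rw [P.f''_zero]
  convert h using 2
  · simp only [Pi.div_apply]; ring
  · ring

/-! ### Conclusion for both topologies. -/

theorem theorem8p9 (δ : ℝ) (hδ : δ ∈ Ioo (0 : ℝ) 1) :
    (∀ (a b f : ℕ → ℝ → ℝ) (a₀ f₀ : ℕ → ℝ),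
      (∀ i, IsSolitonS1R3 (a i) (b i) (f i) (a₀ i) (f₀ i)) →
      (∀ i, a₀ i ∈ Icc δ (1 / δ)) →
      (∀ i, f₀ i < 0) →
      Tendsto f₀ atTop (𝓝 0) →
      ∃ a'inf b'inf : ℕ → ℝ,
        (∀ i, HasAsymptoticSlopes (a i) (b i) (a'inf i) (b'inf i)) ∧
        Tendsto a'inf atTop atTop ∧ Tendsto b'inf atTop atTop) ∧
    (∀ (a b f : ℕ → ℝ → ℝ) (b₀ f₀ : ℕ → ℝ),
      (∀ i, IsSolitonS2R2 (a i) (b i) (f i) (b₀ i) (f₀ i)) →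
      (∀ i, b₀ i ∈ Icc δ (1 / δ)) →
      (∀ i, f₀ i < 0) →
      Tendsto f₀ atTop (𝓝 0) →
      ∃ a'inf b'inf : ℕ → ℝ,
        (∀ i, HasAsymptoticSlopes (a i) (b i) (a'inf i) (b'inf i)) ∧
        Tendsto a'inf atTop atTop ∧ Tendsto b'inf atTop atTop) := by
  have hδ0 : 0 < δ := hδ.1
  refine ⟨?_, ?_⟩
  · intro a b f a₀ f₀ hsol ha₀ hf₀ hlim
    have S i := (hsol i).reducedExpander (hδ0.trans_le (ha₀ i).1) (hf₀ i)
    choose la hla hla' using fun i => (S i).exists_slope_a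
    choose lb hlb hlb' using fun i => (S i).exists_slope_b
    have hc : Tendsto (fun i => -3 * f₀ i) atTop (𝓝 0) := by simpa using hlim.const_mul (-3)
    refine ⟨la, lb, fun i => ⟨hla i, hlb i⟩, ?_, ?_⟩
    · refine tendsto_div_sqrt_atTop hδ0 (fun i => (S i).c_pos) hc (fun i => (ha₀ i).1)
        (fun i => ?_)
      have h := hla' i 0 le_rfl
      rwa [(S i).F_zero, mul_zero, zero_add, (hsol i).a_zero] at h
    · refine tendsto_atTop_of_collapsing one_pos hc (fun i => rfl)
        (fun i => (S i).s_pos zero_le_one) (fun i => ?_) (fun i => ?_)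
        (fun i => hlb' i 1 zero_le_one)
      · simpa using (S i).s_le_exp zero_le_one
      · rw [one_mul]
        exact (S i).exp_le_b_one (by rw [(hsol i).b_zero, mul_zero])
  · intro a b f b₀ f₀ hsol hb₀ hf₀ hlim
    have S i := (hsol i).reducedExpander (hδ0.trans_le (hb₀ i).1) (hf₀ i)
    choose la hla hla' using fun i => (S i).exists_slope_a
    choose lb hlb hlb' using fun i => (S i).exists_slope_b
    have hc : Tendsto (fun i => -2 * f₀ i) atTop (𝓝 0) := by simpa using hlim.const_mul (-2)
    refine ⟨la, lb, fun i => ⟨hla i, hlb i⟩, ?_, ?_⟩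
    -- This `K` is a uniform lower bound for b₀²/(1 + b₀²), which increases with b₀ ≥ δ.
    · refine tendsto_atTop_of_collapsing (K := δ ^ 2 / (1 + δ ^ 2)) (by positivity) hc
        (fun i => rfl) (fun i => (S i).s_pos zero_le_one) (fun i => ?_) (fun i => ?_)
        (fun i => hla' i 1 zero_le_one)
      · simpa using (S i).s_le_exp zero_le_one
      · refine le_trans ?_ ((S i).exp_le_a_one (hsol i).a'_zero (hsol i).a_zero.ge)
        rw [(hsol i).b_zero]
        have hb := (hb₀ i).1
        gcongr ?_ * _
        rw [div_le_div_iff₀ (by positivity) (by positivity)]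
        nlinarith
    · refine tendsto_div_sqrt_atTop hδ0 (fun i => (S i).c_pos) hc (fun i => (hb₀ i).1)
        (fun i => ?_)
      have h := hlb' i 0 le_rfl
      rwa [(S i).F_zero, mul_zero, zero_add, (hsol i).b_zero] at h
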